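/- Let $r\ge 2$ and $n\ge 1$ be integers, and let $K_n^r$ be the $r$-complete hypergraph of order $n$: its vertex set is $V=\{1,\dots,n\}$ and its edges are all the $r$-element subsets of $V$. For $\lambda\in\mathbb N=\{0,1,2,\dots\}$ let $\chi_{K_n^r}(\lambda)$ be the number of maps $\pi:V\to\{1,\dots,\lambda\}$ such that every edge contains two vertices $x,y$ with $\pi(x)\ne\pi(y)$. Then there is exactly one polynomial with integer coefficients whose value at every $\lambda\in\mathbb N$ is $\chi_{K_n^r}(\lambda)$ (the chromatic polynomial of $K_n^r$), and its coefficient $a_1(K_n^r)$ of $\lambda^1$ is $$a_1(K_n^r) = -(n-1)!\,\sum_{i=1}^{r-1} R_i^{-n},$$ where $R_1,\dots,R_{r-1}\in\mathbb C$ are the roots, listed with multiplicity, of the Taylor polynomial $E_{r-1}(x)=\sum_{k=0}^{r-1}\frac{x^k}{k!}$ of $\exp$ at $0$. -/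

import Mathlib

open scoped Nat Polynomial

/-- The `r`-complete hypergraph of order `n`: it has `n` vertices, and its edges are all the
sets of exactly `r` vertices. -/
def rCompleteHypergraph (n r : ℕ) : Hypergraph (Fin n) where
  vertexSet := Set.univ
  edgeSet := {e | e.ncard = r}
  subset_vertexSet_of_mem_edgeSet' := fun e _ => Set.subset_univ e

/-- A colouring `π` of the vertices of `H` is proper if every edge contains two vertices of
different colours. -/
def IsProperColouring {α : Type*} (H : Hypergraph α) {l : ℕ} (π : H.vertexSet → Fin l) : Prop :=
  ∀ e ∈ H.edgeSet, ∃ x y : H.vertexSet, (x : α) ∈ e ∧ (y : α) ∈ e ∧ π x ≠ π y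

/-- The number of proper `l`-colourings of `H`. -/
noncomputable def numProperColourings {α : Type*} (H : Hypergraph α) (l : ℕ) : ℕ :=
  Nat.card {π : H.vertexSet → Fin l // IsProperColouring H π}

/-- `P` is the chromatic polynomial of `H`: its value at each natural number `l` is the number
of proper `l`-colourings of `H`. -/
def IsChromaticPolynomial {α : Type*} (H : Hypergraph α) (P : ℤ[X]) : Prop :=
  ∀ l : ℕ, P.eval (l : ℤ) = (numProperColourings H l : ℤ)

/-- The `m`-th Taylor polynomial `1 + X + X ^ 2 / 2! + ... + X ^ m / m !` of the exponential
function at `0`. -/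
noncomputable def expTaylor (m : ℕ) : ℂ[X] :=
  ∑ k ∈ Finset.range (m + 1), Polynomial.C ((k ! : ℂ)⁻¹) * Polynomial.X ^ k

/-- The sum of `R ^ (-n)` over the complex roots `R`, with multiplicity, of the `m`-th Taylor
polynomial of the exponential function. -/
noncomputable def expTaylorRootMoment (m n : ℕ) : ℂ :=
  ((expTaylor m).roots.map fun R => R ^ (-(n : ℤ))).sum

/-! Write E for E_{r-1} and P_n for the chromatic polynomial of K_n^r. A colouring is proper iff its
fibres have fewer than r elements, so the χ_n(l) have exponential generating function E^l
(`expTaylor_pow_eq_mk`). Differentiating E^(l+1) gives a recurrence with a factor l + 1, whence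
P_(n+1) is X times a combination of the P_k(X - 1), k ≤ n. So the coefficient of X in P_(n+1) is n!
[x^n] E'·F, where F = ∑ P_k(-1) x^k/k!. Extending E^(l+1) = E·E^l to l = -1 gives E·F = 1. The
coefficient is therefore read off E'/E, whose expansion at 0 is -∑ p_(k+1) x^k, with p_k the sum of
the R^(-k). -/

/-- The maps `α → β` all of whose fibres have fewer than `r` elements. -/
abbrev SmallFibreMap (r : ℕ) (α β : Type*) : Type _ :=
  {f : α → β // ∀ b, Nat.card {a // f a = b} < r}

/-! ### Counting maps with small fibres. -/

namespace SmallFibreMap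

theorem card_congr_left (r : ℕ) {α α' : Type*} (β : Type*) (e : α ≃ α') :
    Nat.card (SmallFibreMap r α β) = Nat.card (SmallFibreMap r α' β) := by
  refine Nat.card_congr ((e.arrowCongr (Equiv.refl β)).subtypeEquiv fun f => ?_)
  refine forall_congr' fun b => ?_
  rw [Nat.card_congr (e.subtypeEquiv (q := fun a => (e.arrowCongr (Equiv.refl β)) f a = b)
    fun a => by simp)]

theorem card_congr_right (r : ℕ) (α : Type*) {β β' : Type*} (e : β ≃ β') :
    Nat.card (SmallFibreMap r α β) = Nat.card (SmallFibreMap r α β') := by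
  refine Nat.card_congr (((Equiv.refl α).arrowCongr e).subtypeEquiv fun f => ?_)
  refine e.forall_congr fun b => ?_
  simp

/-- Maps to `Option β` with a prescribed fibre `S` over `none` are maps from the complement
of `S` to `β`. -/
theorem card_none_fibre (r : ℕ) {α β : Type*} [Fintype α] [DecidableEq α] (S : Finset α)
    (hS : S.card < r) :
    Nat.card {f : SmallFibreMap r α (Option β) // ∀ a, f.1 a = none ↔ a ∈ S} =
      Nat.card (SmallFibreMap r {a // a ∉ S} β) := by
  classical
  have key : ∀ (g : {a // a ∉ S} → β) (b : β),
      Nat.card {a // (if h : a ∈ S then none else some (g ⟨a, h⟩)) = some b} =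
        Nat.card {a // g a = b} := fun g b =>
    Nat.card_congr
      { toFun := fun a => ⟨⟨a.1, fun h => by simpa [h] using a.2⟩, by
          have h : a.1 ∉ S := fun h => by simpa [h] using a.2
          simpa [h] using a.2⟩
        invFun := fun a => ⟨a.1.1, by simpa [a.1.2] using a.2⟩
        left_inv := fun a => rfl
        right_inv := fun a => rfl }
  symm
  refine Nat.card_eq_of_bijective (fun g => ⟨⟨fun a => if h : a ∈ S then none
    else some (g.1 ⟨a, h⟩), ?_⟩, fun a => ?_⟩) ⟨?_, ?_⟩
  · rintro (_ | b)
    · have : Nat.card {a // (if h : a ∈ S then none else some (g.1 ⟨a, h⟩)) = none} = S.card := by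
        rw [← Nat.card_eq_finsetCard]
        exact Nat.card_congr (Equiv.subtypeEquivRight fun a => by simp)
      exact this ▸ hS
    · rw [key]; exact g.2 b
  · by_cases h : a ∈ S <;> simp [h]
  · intro g g' h
    ext a
    have := congrFun (congrArg (fun f => f.1.1) h) a.1
    simpa [a.2] using this
  · rintro ⟨⟨f, hf⟩, hS'⟩
    have hs : ∀ a : {a // a ∉ S}, (f a.1).isSome := fun a => by
      rw [Option.isSome_iff_ne_none]; exact fun h => a.2 ((hS' a.1).1 h)
    have hfg : (fun a => if h : a ∈ S then none else some ((f a).get (hs ⟨a, h⟩))) = f := by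
      funext a
      by_cases h : a ∈ S
      · rw [dif_pos h]; exact ((hS' a).2 h).symm
      · simp [h]
    refine ⟨⟨fun a => (f a.1).get (hs a), fun b => ?_⟩, ?_⟩
    · rw [← key (fun a => (f a.1).get (hs a)) b]
      simp only [funext_iff] at hfg
      simp only [hfg]
      exact hf _
    · exact Subtype.ext (Subtype.ext hfg)

/-- Sort the maps by their fibre over `none`: only its size j matters, and there are `n.choose j`
such sets. -/
theorem card_option (r n : ℕ) (β : Type*) [Fintype β] :
    Nat.card (SmallFibreMap r (Fin n) (Option β)) =
      ∑ j ∈ Finset.range (n + 1),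
        if j < r then n.choose j * Nat.card (SmallFibreMap r (Fin (n - j)) β) else 0 := by
  classical
  have h : Nat.card (SmallFibreMap r (Fin n) (Option β)) =
      ∑ S : Finset (Fin n),
        if S.card < r then Nat.card (SmallFibreMap r (Fin (n - S.card)) β) else 0 := by
    have e : SmallFibreMap r (Fin n) (Option β) ≃ Σ S : Finset (Fin n),
        {f : SmallFibreMap r (Fin n) (Option β) //
          (Finset.univ.filter fun a => f.1 a = none) = S} :=
      (Equiv.sigmaFiberEquiv _).symm
    rw [Nat.card_congr e, Nat.card_sigma]
    refine Finset.sum_congr rfl fun S _ => ?_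
    split_ifs with hS
    · rw [card_congr_left r β (α := Fin (n - S.card)) (α' := {a // a ∉ S})
        (Fintype.equivOfCardEq (by simp)), ← card_none_fibre r S hS]
      exact Nat.card_congr (Equiv.subtypeEquivRight fun f => by simp [Finset.ext_iff])
    · rw [Nat.card_eq_zero]
      refine Or.inl ⟨fun f => hS ?_⟩
      have := f.1.2 none
      rw [Nat.card_eq_fintype_card, Fintype.card_subtype, f.2] at this
      exact this
  rw [h, ← Finset.powerset_univ, Finset.sum_powerset_apply_card
    (fun j => if j < r then Nat.card (SmallFibreMap r (Fin (n - j)) β) else 0)]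
  simp

end SmallFibreMap

theorem isProperColouring_rCompleteHypergraph_iff {n r l : ℕ}
    (π : (rCompleteHypergraph n r).vertexSet → Fin l) (hr : 0 < r) :
    IsProperColouring (rCompleteHypergraph n r) π ↔ ∀ b, Nat.card {a // π a = b} < r := by
  classical
  constructor
  · intro h b
    by_contra! hb
    have hb' : r ≤ (Subtype.val '' {a | π a = b} : Set (Fin n)).ncard := by
      rw [Set.ncard_image_of_injective _ Subtype.val_injective]
      exact hb
    obtain ⟨e, he, hc⟩ := Set.exists_subset_card_eq hb'
    obtain ⟨x, y, hx, hy, hxy⟩ := h e hc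
    obtain ⟨x', hx', hxx⟩ := he hx
    obtain ⟨y', hy', hyy⟩ := he hy
    rw [Subtype.ext hxx] at hx'
    rw [Subtype.ext hyy] at hy'
    exact hxy (hx'.trans hy'.symm)
  · intro h e he
    by_contra! hc
    have he' : e.ncard = r := he
    -- Since r > 0, a monochromatic edge has a vertex, whose colour names the fibre containing the
    -- edge.
    obtain ⟨x, hx⟩ := Set.nonempty_of_ncard_ne_zero (by omega : e.ncard ≠ 0)
    have hsub : e ⊆ Subtype.val '' {a | π a = π ⟨x, trivial⟩} := fun y hy =>
      ⟨⟨y, trivial⟩, hc ⟨y, trivial⟩ ⟨x, trivial⟩ hy hx, rfl⟩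
    have h1 := Set.ncard_le_ncard hsub (Set.toFinite _)
    rw [Set.ncard_image_of_injective _ Subtype.val_injective] at h1
    have h2 : ({a | π a = π ⟨x, trivial⟩} : Set _).ncard < r := h (π ⟨x, trivial⟩)
    exact absurd (h1.trans_lt h2) (by omega)

theorem numProperColourings_rCompleteHypergraph {n r : ℕ} (hr : 0 < r) (l : ℕ) :
    numProperColourings (rCompleteHypergraph n r) l =
      Nat.card (SmallFibreMap r (Fin n) (Fin l)) := by
  rw [numProperColourings, Nat.card_congr (Equiv.subtypeEquivRight fun π =>
    isProperColouring_rCompleteHypergraph_iff π hr)]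
  exact SmallFibreMap.card_congr_left r (Fin l) (Equiv.Set.univ (Fin n))

theorem numProperColourings_rCompleteHypergraph_succ {n r : ℕ} (hr : 0 < r) (l : ℕ) :
    numProperColourings (rCompleteHypergraph n r) (l + 1) =
      ∑ j ∈ Finset.range (n + 1),
        if j < r then n.choose j * numProperColourings (rCompleteHypergraph (n - j) r) l else 0 := by
  simp only [numProperColourings_rCompleteHypergraph hr]
  rw [SmallFibreMap.card_congr_right r _ (finSuccEquiv l), SmallFibreMap.card_option]

theorem numProperColourings_rCompleteHypergraph_order_zero {r : ℕ} (hr : 0 < r) (l : ℕ) :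
    numProperColourings (rCompleteHypergraph 0 r) l = 1 := by
  rw [numProperColourings_rCompleteHypergraph hr]
  have : Unique (SmallFibreMap r (Fin 0) (Fin l)) :=
    { default := ⟨finZeroElim, fun b => by simpa using hr⟩
      uniq := fun f => Subtype.ext (Subsingleton.elim _ _) }
  exact Nat.card_unique

theorem numProperColourings_rCompleteHypergraph_zero {n r : ℕ} (hr : 0 < r) :
    numProperColourings (rCompleteHypergraph n r) 0 = if n = 0 then 1 else 0 := by
  split_ifs with hn
  · subst hn
    exact numProperColourings_rCompleteHypergraph_order_zero hr 0
  · rw [numProperColourings_rCompleteHypergraph hr, Nat.card_eq_zero]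
    exact Or.inl ⟨fun f => (f.1 ⟨0, by omega⟩).elim0⟩

/-! ### Exponential generating functions. -/

theorem coeff_expTaylor (m j : ℕ) :
    (expTaylor m).coeff j = if j < m + 1 then ((j ! : ℂ)⁻¹) else 0 := by
  simp [expTaylor, Polynomial.coeff_C_mul, Polynomial.coeff_X_pow]

theorem PowerSeries.coeff_mk_div_factorial_mul (f g : ℕ → ℂ) (n : ℕ) :
    PowerSeries.coeff n (PowerSeries.mk (fun k => f k / k !) * PowerSeries.mk fun k => g k / k !) =
      (∑ j ∈ Finset.range (n + 1), (n.choose j : ℂ) * f j * g (n - j)) / n ! := by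
  rw [PowerSeries.coeff_mul, Finset.Nat.sum_antidiagonal_eq_sum_range_succ_mk, Finset.sum_div]
  refine Finset.sum_congr rfl fun j hj => ?_
  rw [Nat.cast_choose ℂ (Finset.mem_range_succ_iff.1 hj)]
  have := Nat.factorial_ne_zero n
  have := Nat.factorial_ne_zero j
  have := Nat.factorial_ne_zero (n - j)
  simp only [PowerSeries.coeff_mk]
  field_simp

theorem coe_expTaylor (m : ℕ) :
    (expTaylor m : PowerSeries ℂ) =
      PowerSeries.mk fun k => (if k < m + 1 then (1 : ℂ) else 0) / k ! := by
  ext k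
  rw [Polynomial.coeff_coe, coeff_expTaylor, PowerSeries.coeff_mk]
  split_ifs <;> simp

theorem coe_derivative_expTaylor (m : ℕ) :
    ((expTaylor m).derivative : PowerSeries ℂ) =
      PowerSeries.mk fun k => (if k < m then (1 : ℂ) else 0) / k ! := by
  ext k
  rw [Polynomial.coeff_coe, Polynomial.coeff_derivative, coeff_expTaylor, PowerSeries.coeff_mk]
  have := Nat.factorial_ne_zero k
  have : (k : ℂ) + 1 ≠ 0 := by exact_mod_cast k.succ_ne_zero
  simp only [Nat.add_lt_add_iff_right]
  split_ifs
  · rw [Nat.factorial_succ]; push_cast; field_simp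
  · simp

/-- The exponential generating function in `n` of the numbers of proper `l`-colourings. -/
theorem expTaylor_pow_eq_mk (m l : ℕ) :
    (expTaylor m : PowerSeries ℂ) ^ l =
      PowerSeries.mk fun n =>
        (numProperColourings (rCompleteHypergraph n (m + 1)) l : ℂ) / n ! := by
  induction l with
  | zero =>
    ext n
    rw [pow_zero, PowerSeries.coeff_one, PowerSeries.coeff_mk,
      numProperColourings_rCompleteHypergraph_zero m.succ_pos]
    split_ifs with h <;> simp [h]
  | succ l ih =>
    rw [pow_succ', ih, coe_expTaylor]
    ext n
    rw [PowerSeries.coeff_mk_div_factorial_mul, PowerSeries.coeff_mk,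
      numProperColourings_rCompleteHypergraph_succ m.succ_pos]
    push_cast
    congr 1
    exact Finset.sum_congr rfl fun j _ => by split_ifs <;> simp

/-- Compare coefficients in (E^(l+1))' = (l+1) E^l E'. -/
theorem numProperColourings_rCompleteHypergraph_succ_succ (m n l : ℕ) :
    numProperColourings (rCompleteHypergraph (n + 1) (m + 1)) (l + 1) =
      (l + 1) * ∑ j ∈ Finset.range (n + 1),
        if j < m then n.choose j * numProperColourings (rCompleteHypergraph (n - j) (m + 1)) l
        else 0 := by
  have h := congrArg (PowerSeries.coeff n)
    (congrArg (PowerSeries.derivative ℂ) (expTaylor_pow_eq_mk m (l + 1)))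
  rw [Derivation.leibniz_pow, PowerSeries.derivative_coe, Nat.add_sub_cancel,
    expTaylor_pow_eq_mk, coe_derivative_expTaylor, smul_eq_mul, mul_comm (PowerSeries.mk _),
    map_nsmul, PowerSeries.coeff_mk_div_factorial_mul,
    PowerSeries.coeff_derivative, PowerSeries.coeff_mk, nsmul_eq_mul, Nat.factorial_succ] at h
  have hn : (n ! : ℂ) ≠ 0 := by exact_mod_cast Nat.factorial_ne_zero n
  have hn' : (n : ℂ) + 1 ≠ 0 := by exact_mod_cast n.succ_ne_zero
  push_cast at h
  field_simp at h
  rw [← Nat.cast_inj (R := ℂ)]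
  push_cast
  rw [← h]
  congr 1
  exact Finset.sum_congr rfl fun j _ => by split_ifs <;> simp

/-! ### Existence and uniqueness of the chromatic polynomial. -/

theorem isChromaticPolynomial_rCompleteHypergraph_succ {m n : ℕ} {P : ℕ → ℤ[X]}
    (hP : ∀ k ≤ n, IsChromaticPolynomial (rCompleteHypergraph k (m + 1)) (P k)) :
    IsChromaticPolynomial (rCompleteHypergraph (n + 1) (m + 1))
      (Polynomial.X * ∑ j ∈ Finset.range (n + 1),
        if j < m then Polynomial.C (n.choose j : ℤ) * (P (n - j)).comp (Polynomial.X - 1)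
        else 0) := by
  rintro (_ | l)
  -- At 0 the factor X vanishes, so the values at -1 play no role.
  · simp [numProperColourings_rCompleteHypergraph_zero]
  · rw [numProperColourings_rCompleteHypergraph_succ_succ, Polynomial.eval_mul,
      Polynomial.eval_finsetSum]
    push_cast
    rw [Polynomial.eval_X]
    congr 1
    refine Finset.sum_congr rfl fun j _ => ?_
    split_ifs
    · simp [Polynomial.eval_comp, hP (n - j) (Nat.sub_le _ _) l]
    · simp

theorem exists_isChromaticPolynomial_rCompleteHypergraph (m n : ℕ) :
    ∃ P : ℤ[X], IsChromaticPolynomial (rCompleteHypergraph n (m + 1)) P := by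
  induction n using Nat.strong_induction_on with
  | _ n ih =>
    rcases n with _ | n
    · exact ⟨1, fun l => by
        simp [numProperColourings_rCompleteHypergraph_order_zero m.succ_pos]⟩
    · choose! P hP using ih
      exact ⟨_, isChromaticPolynomial_rCompleteHypergraph_succ fun k hk =>
        hP k (Nat.lt_succ_of_le hk)⟩

theorem Polynomial.eq_of_eval_natCast_eq {P Q : ℤ[X]}
    (h : ∀ l : ℕ, P.eval (l : ℤ) = Q.eval (l : ℤ)) : P = Q :=
  Polynomial.eq_of_infinite_eval_eq P Q
    ((Set.infinite_range_of_injective Nat.cast_injective).mono (by rintro _ ⟨l, rfl⟩; exact h l))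

theorem IsChromaticPolynomial.unique {α : Type*} {H : Hypergraph α} {P Q : ℤ[X]}
    (hP : IsChromaticPolynomial H P) (hQ : IsChromaticPolynomial H Q) : P = Q :=
  Polynomial.eq_of_eval_natCast_eq fun l => (hP l).trans (hQ l).symm

/-! ### The linear coefficient through values at -1. -/

section family

variable {m : ℕ} {P : ℕ → ℤ[X]}

theorem comp_X_add_one_of_isChromaticPolynomial
    (hP : ∀ n, IsChromaticPolynomial (rCompleteHypergraph n (m + 1)) (P n)) (n : ℕ) :
    (P n).comp (Polynomial.X + 1) = ∑ j ∈ Finset.range (n + 1),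
      if j < m + 1 then Polynomial.C (n.choose j : ℤ) * P (n - j) else 0 := by
  refine Polynomial.eq_of_eval_natCast_eq fun l => ?_
  have h := hP n (l + 1)
  rw [numProperColourings_rCompleteHypergraph_succ m.succ_pos] at h
  push_cast at h
  rw [Polynomial.eval_comp, Polynomial.eval_finsetSum]
  simp only [Polynomial.eval_add, Polynomial.eval_X, Polynomial.eval_one]
  rw [h]
  refine Finset.sum_congr rfl fun j _ => ?_
  split_ifs
  · simp [hP (n - j) l]
  · simp

theorem eq_X_mul_of_isChromaticPolynomial
    (hP : ∀ n, IsChromaticPolynomial (rCompleteHypergraph n (m + 1)) (P n)) (n : ℕ) :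
    P (n + 1) = Polynomial.X * ∑ j ∈ Finset.range (n + 1),
      if j < m then Polynomial.C (n.choose j : ℤ) * (P (n - j)).comp (Polynomial.X - 1) else 0 := by
  exact (hP (n + 1)).unique (isChromaticPolynomial_rCompleteHypergraph_succ fun k _ => hP k)

/-- Evaluate the shift identity for P_n(X + 1) at -1: its left side is P_n(0), which is 1 for n = 0
and 0 otherwise. -/
theorem expTaylor_mul_mk_eval_neg_one
    (hP : ∀ n, IsChromaticPolynomial (rCompleteHypergraph n (m + 1)) (P n)) :
    (expTaylor m : PowerSeries ℂ) *
      PowerSeries.mk (fun n => (((P n).eval (-1) : ℤ) : ℂ) / n !) = 1 := by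
  ext n
  rw [coe_expTaylor, PowerSeries.coeff_mk_div_factorial_mul, PowerSeries.coeff_one]
  have h := congrArg (Polynomial.eval (-1)) (comp_X_add_one_of_isChromaticPolynomial hP n)
  rw [Polynomial.eval_comp, Polynomial.eval_finsetSum] at h
  have h0 := hP n 0
  rw [numProperColourings_rCompleteHypergraph_zero m.succ_pos] at h0
  simp only [Polynomial.eval_add, Polynomial.eval_X, Polynomial.eval_one, neg_add_cancel] at h
  push_cast at h0
  rw [h0] at h
  have h' := congrArg (fun z : ℤ => (z : ℂ)) h
  push_cast at h'
  have h2 : ∑ j ∈ Finset.range (n + 1), (n.choose j : ℂ) * (if j < m + 1 then (1 : ℂ) else 0) *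
      (((P (n - j)).eval (-1) : ℤ) : ℂ) = if n = 0 then 1 else 0 := by
    rw [h']
    refine Finset.sum_congr rfl fun j _ => ?_
    split_ifs <;> simp
  rw [h2]
  split_ifs with hn <;> simp [hn]

theorem coeff_one_of_isChromaticPolynomial
    (hP : ∀ n, IsChromaticPolynomial (rCompleteHypergraph n (m + 1)) (P n)) (n : ℕ) :
    ((P (n + 1)).coeff 1 : ℂ) = n ! * PowerSeries.coeff n
      (((expTaylor m).derivative : PowerSeries ℂ) *
        PowerSeries.mk (fun n => (((P n).eval (-1) : ℤ) : ℂ) / n !)) := by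
  have := Nat.factorial_ne_zero n
  rw [coe_derivative_expTaylor, PowerSeries.coeff_mk_div_factorial_mul,
    mul_div_cancel₀ _ (by exact_mod_cast this), eq_X_mul_of_isChromaticPolynomial hP,
    Polynomial.coeff_X_mul, Polynomial.coeff_zero_eq_eval_zero, Polynomial.eval_finsetSum]
  push_cast
  refine Finset.sum_congr rfl fun j _ => ?_
  split_ifs <;> simp [Polynomial.eval_comp]

end family

/-! ### Logarithmic derivative and inverse power sums of roots. -/

/-- The power sums of the inverses of the roots are the coefficients of the logarithmic
derivative. -/
theorem coe_derivative_multiset_prod_X_sub_C (s : Multiset ℂ) (hs : ∀ R ∈ s, R ≠ 0) :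
    (((s.map fun R => Polynomial.X - Polynomial.C R).prod.derivative : ℂ[X]) : PowerSeries ℂ) =
      ((s.map fun R => Polynomial.X - Polynomial.C R).prod : ℂ[X]) *
        PowerSeries.mk fun k => -(s.map fun R => R ^ (-((k + 1 : ℕ) : ℤ))).sum := by
  induction s using Multiset.induction with
  | empty =>
    have : (PowerSeries.mk fun _ => (0 : ℂ)) = 0 := by ext; simp
    simp [this]
  | cons R s ih =>
    have hR : R ≠ 0 := hs R (Multiset.mem_cons_self _ _)
    -- Geometric series for 1/(X - R) at 0.
    have h1 : ((Polynomial.X - Polynomial.C R : ℂ[X]) : PowerSeries ℂ) *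
        (PowerSeries.mk fun k => -R ^ (-((k + 1 : ℕ) : ℤ))) = 1 := by
      ext k
      rw [Polynomial.coe_sub, Polynomial.coe_X, Polynomial.coe_C, sub_mul, map_sub,
        PowerSeries.coeff_C_mul, PowerSeries.coeff_mk, PowerSeries.coeff_one]
      rcases k with _ | k
      · simp [hR]
      · rw [PowerSeries.coeff_succ_X_mul, PowerSeries.coeff_mk]
        simp only [zpow_neg, zpow_natCast]
        rw [if_neg k.succ_ne_zero]
        field_simp
        ring
    have h2 : (PowerSeries.mk fun k => -((R ::ₘ s).map fun R => R ^ (-((k + 1 : ℕ) : ℤ))).sum) =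
        (PowerSeries.mk fun k => -R ^ (-((k + 1 : ℕ) : ℤ))) +
        PowerSeries.mk fun k => -(s.map fun R => R ^ (-((k + 1 : ℕ) : ℤ))).sum := by
      ext k
      simp only [map_add, PowerSeries.coeff_mk, Multiset.map_cons, Multiset.sum_cons, neg_add]
    rw [h2, Multiset.map_cons, Multiset.prod_cons, Polynomial.derivative_mul,
      Polynomial.derivative_X_sub_C, one_mul, Polynomial.coe_add, Polynomial.coe_mul,
      Polynomial.coe_mul, ih fun R hR => hs R (Multiset.mem_cons_of_mem hR)]
    linear_combination -(((s.map fun R => Polynomial.X - Polynomial.C R).prod : ℂ[X]) : PowerSeries ℂ) * h1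

/-- E(0) = 1 keeps 0 from being a root; the leading coefficient is a common factor of both sides. -/
theorem coe_derivative_expTaylor_eq_mul (m : ℕ) :
    ((expTaylor m).derivative : PowerSeries ℂ) =
      (expTaylor m : PowerSeries ℂ) *
        PowerSeries.mk fun k => -expTaylorRootMoment m (k + 1) := by
  have h0 : (expTaylor m).coeff 0 = 1 := by simp [coeff_expTaylor]
  have hne : expTaylor m ≠ 0 := fun h => by simp [h] at h0
  have hs : ∀ R ∈ (expTaylor m).roots, R ≠ 0 := by
    rintro R hR rfl
    rw [Polynomial.mem_roots hne, Polynomial.IsRoot, ← Polynomial.coeff_zero_eq_eval_zero, h0] at hR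
    exact one_ne_zero hR
  have h := coe_derivative_multiset_prod_X_sub_C _ hs
  have hsplit := (IsAlgClosed.splits (expTaylor m)).eq_prod_roots
  have hd := congrArg Polynomial.derivative hsplit
  rw [Polynomial.derivative_C_mul] at hd
  rw [hd, Polynomial.coe_mul, h, ← mul_assoc, ← Polynomial.coe_mul, ← hsplit]
  rfl

theorem theorem4p1 (r n : ℕ) (hr : 2 ≤ r) (hn : 1 ≤ n) :
    (∃! P : ℤ[X], IsChromaticPolynomial (rCompleteHypergraph n r) P) ∧
    ∀ P : ℤ[X], IsChromaticPolynomial (rCompleteHypergraph n r) P →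
      (P.coeff 1 : ℂ) = -((n - 1)! : ℂ) * expTaylorRootMoment (r - 1) n := by
  obtain ⟨m, rfl⟩ : ∃ m, r = m + 1 := ⟨r - 1, by omega⟩
  obtain ⟨n, rfl⟩ : ∃ k, n = k + 1 := ⟨n - 1, by omega⟩
  choose P hP using exists_isChromaticPolynomial_rCompleteHypergraph m
  refine ⟨⟨P (n + 1), hP (n + 1), fun Q hQ => hQ.unique (hP _)⟩, fun Q hQ => ?_⟩
  rw [hQ.unique (hP (n + 1)), coeff_one_of_isChromaticPolynomial hP,
    coe_derivative_expTaylor_eq_mul, mul_right_comm, expTaylor_mul_mk_eval_neg_one hP, one_mul,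
    PowerSeries.coeff_mk]
  simp
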